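/- For a bounded linear operator $T$ on a complex Banach space $X$, let $N(T)$ and $R(T)$ be its kernel and range, and let $H_0(T)=\{x\in X:\lim_{n\to\infty}\|T^nx\|^{1/n}=0\}$. $T$ is *quasi-nilpotent* if its spectral radius is $0$, *upper semi-Fredholm* if $\dim N(T)<\infty$ and $R(T)$ is closed, and *Fredholm* if moreover $\operatorname{codim}R(T)<\infty$. $T$ is *pseudo upper semi B-Fredholm* (resp. *pseudo B-Fredholm*) if $X=X_1\oplus X_2$ with $X_1,X_2$ closed and $T$-invariant, $T|_{X_1}$ upper semi-Fredholm (resp. Fredholm) and $T|_{X_2}$ quasi-nilpotent. $T$ is *left generalized Drazin invertible* if $H_0(T)$ is closed and has a closed $T$-invariant complement $M$ in $X$ with $T(M)$ closed. $T$ is *generalized Drazin invertible* if there is a bounded operator $S$ on $X$ such that $ST=TS$, $S^2T=S$ and $T-T^2S$ is quasi-nilpotent. Let $A$ be a semi-simple commutative complex Banach algebra (not necessarily unital), where semi-simple means that the intersection of the kernels of all characters of $A$ is $\{0\}$. Let $T:A\to A$ be a multiplier, i.e. a mapping with $T(x)y=xT(y)$ for all $x,y\in A$. Then $T$ is a bounded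 linear operator, and: 1. $T$ is pseudo upper semi B-Fredholm if and only if $T$ is left generalized Drazin invertible. 2. If in addition $A$ is regular (for every subset $E$ of the character space $\Delta(A)$ that is closed in the weak-$*$ topology and every $\varphi\in\Delta(A)\setminus E$ there is $a\in A$ with $\psi(a)=0$ for all $\psi\in E$ and $\varphi(a)\neq0$) and Tauberian (the elements $a\in A$ whose Gelfand transform has compact support in $\Delta(A)$ are dense in $A$), then $T$ is pseudo B-Fredholm if and only if $T$ is generalized Drazin invertible. -/

import Mathlib

namespace GenDrazin

open Filter Topology

section Operators

variable {X : Type*} [NormedAddCommGroup X] [NormedSpace ℂ X]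

/-- An operator is quasi-nilpotent if its spectral radius is zero. (On the zero space the spectrum
is empty and the zero operator is quasi-nilpotent.) -/
def IsQuasinilpotent (T : X →L[ℂ] X) : Prop :=
  spectralRadius ℂ T = 0

/-- Upper semi-Fredholm operators: finite dimensional kernel and closed range. -/
def IsUpperSemiFredholm (T : X →L[ℂ] X) : Prop :=
  FiniteDimensional ℂ T.ker ∧ IsClosed (T.range : Set X)

/-- `T` is pseudo upper semi B-Fredholm: `X = X₁ ⊕ X₂` with `X₁`, `X₂` closed and `T`-invariant,
`T` restricted to `X₁` is upper semi-Fredholm and `T` restricted to `X₂` is quasi-nilpotent. -/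
def IsPseudoUpperSemiBFredholm (T : X →L[ℂ] X) : Prop :=
  ∃ (X₁ X₂ : Submodule ℂ X) (h₁ : ∀ x ∈ X₁, T x ∈ X₁) (h₂ : ∀ x ∈ X₂, T x ∈ X₂),
    IsClosed (X₁ : Set X) ∧ IsClosed (X₂ : Set X) ∧ IsCompl X₁ X₂ ∧
      IsUpperSemiFredholm (T.restrict h₁) ∧ IsQuasinilpotent (T.restrict h₂)

/-- `T` is pseudo B-Fredholm: `X = X₁ ⊕ X₂` with `X₁`, `X₂` closed and `T`-invariant,
`T` restricted to `X₁` is Fredholm and `T` restricted to `X₂` is quasi-nilpotent. -/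
def IsPseudoBFredholm (T : X →L[ℂ] X) : Prop :=
  ∃ (X₁ X₂ : Submodule ℂ X) (h₁ : ∀ x ∈ X₁, T x ∈ X₁) (h₂ : ∀ x ∈ X₂, T x ∈ X₂),
    IsClosed (X₁ : Set X) ∧ IsClosed (X₂ : Set X) ∧ IsCompl X₁ X₂ ∧
      (T.restrict h₁).IsFredholm ∧ IsQuasinilpotent (T.restrict h₂)

/-- The quasi-nilpotent part `H₀(T) = {x | ‖Tⁿ x‖ ^ (1 / n) → 0}`. -/
def quasinilpotentPart (T : X →L[ℂ] X) : Submodule ℂ X where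
  carrier := {x | Tendsto (fun n : ℕ => ‖(T ^ n) x‖ ^ (1 / (n : ℝ))) atTop (𝓝 0)}
  zero_mem' := by
    refine tendsto_const_nhds.congr' ?_
    filter_upwards [eventually_gt_atTop 0] with n hn
    have : (1 / (n : ℝ)) ≠ 0 := by positivity
    simp [Real.zero_rpow (by simpa using this : ((n : ℝ))⁻¹ ≠ 0)]
  add_mem' := by
    intro x y hx hy
    have hxy := Tendsto.add hx hy
    rw [add_zero] at hxy
    refine squeeze_zero' (Eventually.of_forall fun n => by positivity) ?_ hxy
    filter_upwards [eventually_ge_atTop 1] with n hn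
    have hn' : (1 : ℝ) ≤ n := by exact_mod_cast hn
    have h1 : (1 / (n : ℝ)) ≤ 1 := by
      rw [div_le_one (by linarith)]
      exact hn'
    calc ‖(T ^ n) (x + y)‖ ^ (1 / (n : ℝ))
        ≤ (‖(T ^ n) x‖ + ‖(T ^ n) y‖) ^ (1 / (n : ℝ)) := by
          rw [map_add]
          exact Real.rpow_le_rpow (norm_nonneg _) (norm_add_le _ _) (by positivity)
      _ ≤ _ := Real.rpow_add_le_add_rpow (norm_nonneg _) (norm_nonneg _) (by positivity) h1
  smul_mem' := by
    intro c x hx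
    have hx' : Tendsto (fun n : ℕ => max ‖c‖ 1 * ‖(T ^ n) x‖ ^ (1 / (n : ℝ))) atTop (𝓝 0) := by
      simpa using Tendsto.const_mul (max ‖c‖ 1) hx
    refine squeeze_zero' (Eventually.of_forall fun n => by positivity) ?_ hx'
    filter_upwards [eventually_ge_atTop 1] with n hn
    have hn' : (1 : ℝ) ≤ n := by exact_mod_cast hn
    have h1 : (1 / (n : ℝ)) ≤ 1 := by
      rw [div_le_one (by linarith)]
      exact hn'
    rw [map_smul, norm_smul, Real.mul_rpow (norm_nonneg _) (norm_nonneg _)]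
    refine mul_le_mul_of_nonneg_right ?_ (by positivity)
    calc ‖c‖ ^ (1 / (n : ℝ)) ≤ (max ‖c‖ 1) ^ (1 / (n : ℝ)) :=
          Real.rpow_le_rpow (norm_nonneg _) (le_max_left _ _) (by positivity)
      _ ≤ (max ‖c‖ 1) ^ (1 : ℝ) := Real.rpow_le_rpow_of_exponent_le (le_max_right _ _) h1
      _ = max ‖c‖ 1 := Real.rpow_one _

/-- `T` is left generalized Drazin invertible: `H₀(T)` is closed and has a closed `T`-invariant
complement `M` such that `T(M)` is closed. -/
def IsLeftGenDrazinInvertible (T : X →L[ℂ] X) : Prop :=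
  IsClosed (quasinilpotentPart T : Set X) ∧
    ∃ M : Submodule ℂ X, IsClosed (M : Set X) ∧ IsCompl (quasinilpotentPart T) M ∧
      (∀ x ∈ M, T x ∈ M) ∧ IsClosed (T '' (M : Set X))

/-- `T` is generalized Drazin invertible: there is a bounded operator `S` with `ST = TS`,
`S²T = S` and `T - T²S` quasi-nilpotent. -/
def IsGenDrazinInvertible (T : X →L[ℂ] X) : Prop :=
  ∃ S : X →L[ℂ] X, S * T = T * S ∧ S ^ 2 * T = S ∧ IsQuasinilpotent (T - T ^ 2 * S)

end Operators

section Algebras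

variable (A : Type*) [NonUnitalNormedCommRing A] [NormedSpace ℂ A]

/-- A commutative Banach algebra is semi-simple if its radical, the intersection of the kernels of
all characters (the whole algebra if there are none), is zero. -/
def IsSemisimple : Prop :=
  ∀ a : A, (∀ φ : WeakDual.characterSpace ℂ A, φ a = 0) → a = 0

/-- A commutative Banach algebra is regular if its Gelfand transforms separate the points of the
character space (with the weak-star topology) from the closed subsets. -/
def IsRegular : Prop :=
  ∀ (E : Set (WeakDual.characterSpace ℂ A)) (φ : WeakDual.characterSpace ℂ A), IsClosed E →
    φ ∉ E → ∃ a : A, (∀ ψ ∈ E, ψ a = 0) ∧ φ a ≠ 0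

/-- A commutative Banach algebra is Tauberian if the elements whose Gelfand transform has compact
support in the character space are dense. -/
def IsTauberian : Prop :=
  Dense {a : A | HasCompactSupport fun φ : WeakDual.characterSpace ℂ A => φ a}

/-- A multiplier of `A` is a mapping `T : A → A` with `T(x) y = x T(y)` for all `x`, `y`. -/
def IsMultiplier {A : Type*} [Mul A] (T : A → A) : Prop :=
  ∀ x y : A, T x * y = x * T y

end Algebras

end GenDrazin

namespace GenDrazin

open Filter Topology WeakDual

/-! ### Multipliers, their symbols and their quasi-nilpotent part. -/

section Multipliers

variable {A : Type*} [NonUnitalNormedCommRing A] [NormedSpace ℂ A]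

/-! Each character `φ` turns `T` into multiplication by a scalar, its symbol at `φ`. By
semisimplicity `H₀(T) = N(T)` (`quasinilpotentPart_eq_ker`) and `N(T) ∩ R(T) = 0`, so every
quasi-nilpotent summand lies in `N(T)`. Upper semi-Fredholm case: inside `X₁` the finite-dimensional
kernel has a closed complement containing the range, and this is the required `M`. Conversely `X₁ =
M`, `X₂ = N(T)` works. Fredholm case: if `T` is left generalized Drazin invertible, it is bounded
below on its range by some `c > 0`. Regularity then keeps the nonzero symbol values at modulus at
least `c` (`le_norm_symbol`), so the zero set of the symbol is open. Hence elements with compactly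
supported Gelfand transform lie locally in `N(T) + R(T)`, so they lie in it, and the Tauberian
condition makes this sum dense (`dense_ker_sup_range`). Since `T(M)` is closed, `T(M) = M`, and `T`
is invertible on `M`. -/

theorem IsSemisimple.ext (hA : IsSemisimple A) {a b : A}
    (h : ∀ φ : characterSpace ℂ A, φ a = φ b) : a = b :=
  sub_eq_zero.mp (hA _ fun φ => by rw [map_sub, h, sub_self])

theorem exists_apply_ne_zero (φ : characterSpace ℂ A) : ∃ x, φ x ≠ 0 := by
  by_contra! h
  exact φ.2.1 (ContinuousLinearMap.ext h)

theorem continuous_apply (a : A) : Continuous fun φ : characterSpace ℂ A => φ a :=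
  (WeakDual.eval_continuous a).comp continuous_subtype_val

/-- Multiplier identities become visible only after multiplication by a test element; this cancels
it. -/
theorem IsSemisimple.eq_of_mul_eq (hA : IsSemisimple A) {a b : A} (h : ∀ y, a * y = b * y) :
    a = b := by
  refine hA.ext fun φ => ?_
  obtain ⟨y, hy⟩ := exists_apply_ne_zero φ
  have := congrArg φ (h y)
  rw [map_mul, map_mul] at this
  exact mul_right_cancel₀ hy this

theorem IsMultiplier.map_mul {T : A → A} (hA : IsSemisimple A) (hT : IsMultiplier T) (x y : A) :
    T (x * y) = T x * y := by
  refine hA.eq_of_mul_eq fun z => ?_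
  rw [hT, mul_assoc, mul_left_comm, ← hT, mul_left_comm, mul_assoc]

/-- Multipliers of a semi-simple commutative Banach algebra are linear and bounded. -/
theorem IsMultiplier.exists_continuousLinearMap [IsScalarTower ℂ A A]
    [SMulCommClass ℂ A A] [CompleteSpace A] (hA : IsSemisimple A) {T : A → A}
    (hT : IsMultiplier T) : ∃ S : A →L[ℂ] A, ∀ x, S x = T x := by
  let T' : A →ₗ[ℂ] A :=
    { toFun := T
      map_add' := fun x y => hA.eq_of_mul_eq fun z => by
        rw [add_mul, hT, hT, hT, add_mul]
      map_smul' := fun c x => hA.eq_of_mul_eq fun z => by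
        rw [RingHom.id_apply, hT, smul_mul_assoc, smul_mul_assoc, hT] }
  have hT' : ∀ x, T' x = T x := fun _ => rfl
  refine ⟨ContinuousLinearMap.ofSeqClosedGraph (g := T') ?_, fun x => rfl⟩
  intro u x y hu hy
  refine hA.eq_of_mul_eq fun z => ?_
  have h1 : Tendsto (fun n => T' (u n) * z) atTop (𝓝 (y * z)) := hy.mul_const z
  have h2 : Tendsto (fun n => T' (u n) * z) atTop (𝓝 (T' x * z)) := by
    simp only [hT', hT _ z]
    exact hu.mul_const _
  exact tendsto_nhds_unique h1 h2

theorem IsMultiplier.exists_symbol {T : A → A} (hT : IsMultiplier T)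
    (φ : characterSpace ℂ A) : ∃ s : ℂ, ∀ y, φ (T y) = s * φ y := by
  obtain ⟨x, hx⟩ := exists_apply_ne_zero φ
  refine ⟨φ (T x) / φ x, fun y => ?_⟩
  have := congrArg φ (hT x y)
  rw [_root_.map_mul, _root_.map_mul] at this
  field_simp
  rw [mul_comm, ← this]

theorem apply_pow_eq {T : A →L[ℂ] A} {φ : characterSpace ℂ A} {s : ℂ}
    (hs : ∀ y, φ (T y) = s * φ y) (n : ℕ) (y : A) : φ ((T ^ n) y) = s ^ n * φ y := by
  induction n with
  | zero => simp
  | succ n ih =>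
    rw [pow_succ', mul_apply_eq_comp, hs, ih, pow_succ']
    ring

/-- The quasi-nilpotent part of a multiplier is its kernel. -/
theorem IsMultiplier.quasinilpotentPart_eq_ker (hA : IsSemisimple A) {T : A →L[ℂ] A}
    (hT : IsMultiplier T) : quasinilpotentPart T = T.ker := by
  apply le_antisymm
  · intro x hx
    have hx' : Tendsto (fun n : ℕ => ‖(T ^ n) x‖ ^ (1 / (n : ℝ))) atTop (𝓝 0) := hx
    rw [LinearMap.mem_ker]
    refine hA _ fun φ => ?_
    obtain ⟨s, hs⟩ := hT.exists_symbol φ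
    show φ (T x) = 0
    rw [hs]
    by_contra hne
    obtain ⟨h1, h2⟩ := mul_ne_zero_iff.mp hne
    have hs0 : 0 < ‖s‖ := norm_pos_iff.mpr h1
    have hp : 0 < ‖φ x‖ := norm_pos_iff.mpr h2
    -- The added 1 makes positivity of `C` immediate.
    let C : ℝ := ‖CharacterSpace.toCLM φ‖ + 1
    have hC : 0 < C := by positivity
    have hbound : ∀ n : ℕ, ‖s‖ ^ n * (‖φ x‖ / C) ≤ ‖(T ^ n) x‖ := by
      intro n
      rw [← mul_div_assoc, div_le_iff₀ hC, ← norm_pow, ← norm_mul, ← apply_pow_eq hs, mul_comm]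
      refine ((CharacterSpace.toCLM φ).le_opNorm _).trans ?_
      gcongr
      simp [C]
    have hroot : Tendsto (fun n : ℕ => (‖φ x‖ / C) ^ (1 / (n : ℝ))) atTop (𝓝 1) := by
      have h0 : Tendsto (fun n : ℕ => 1 / (n : ℝ)) atTop (𝓝 0) := tendsto_one_div_atTop_nhds_zero_nat
      have := (tendsto_const_nhds (x := ‖φ x‖ / C)).rpow h0 (Or.inl (by positivity))
      simpa using this
    have hle : ‖s‖ * 1 ≤ 0 := by
      refine le_of_tendsto_of_tendsto (hroot.const_mul ‖s‖) hx' ?_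
      filter_upwards [eventually_gt_atTop 0] with n hn
      calc ‖s‖ * (‖φ x‖ / C) ^ (1 / (n : ℝ))
          = (‖s‖ ^ n * (‖φ x‖ / C)) ^ (1 / (n : ℝ)) := by
            rw [Real.mul_rpow (by positivity) (by positivity), one_div,
              Real.pow_rpow_inv_natCast hs0.le hn.ne']
        _ ≤ _ := Real.rpow_le_rpow (by positivity) (hbound n) (by positivity)
    linarith
  · intro x hx
    have hx0 : T x = 0 := hx
    refine tendsto_const_nhds.congr' ?_
    filter_upwards [eventually_gt_atTop 0] with n hn
    obtain ⟨m, rfl⟩ := Nat.exists_eq_succ_of_ne_zero hn.ne'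
    have : (1 / ((m.succ : ℕ) : ℝ)) ≠ 0 := by positivity
    rw [pow_succ, mul_apply_eq_comp, hx0, map_zero, norm_zero, Real.zero_rpow this]

theorem IsMultiplier.apply_eq_zero_of_apply_apply_eq_zero (hA : IsSemisimple A) {T : A → A}
    (hT : IsMultiplier T) {x : A} (hx : T (T x) = 0) : T x = 0 := by
  refine hA _ fun φ => ?_
  obtain ⟨s, hs⟩ := hT.exists_symbol φ
  have h := congrArg φ hx
  rw [hs, hs, map_zero] at h
  rw [hs]
  rcases mul_eq_zero.mp h with h | h
  · rw [h, zero_mul]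
  · exact h

end Multipliers

/-! ### Quasi-nilpotent operators and restrictions. -/

section Operators

variable {X : Type*} [NormedAddCommGroup X] [NormedSpace ℂ X]

theorem isQuasinilpotent_zero : IsQuasinilpotent (0 : X →L[ℂ] X) := by
  simp [IsQuasinilpotent]

theorem mem_quasinilpotentPart_of_isQuasinilpotent [CompleteSpace X] {T : X →L[ℂ] X}
    (hT : IsQuasinilpotent T) (x : X) : x ∈ quasinilpotentPart T := by
  have h := spectrum.pow_norm_pow_one_div_tendsto_nhds_spectralRadius T
  rw [hT] at h
  have h1 : Tendsto (fun n : ℕ => ‖T ^ n‖ ^ (1 / (n : ℝ))) atTop (𝓝 0) := by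
    have := (ENNReal.tendsto_toReal ENNReal.zero_ne_top).comp h
    refine (this.congr fun n => ?_)
    exact ENNReal.toReal_ofReal (by positivity)
  have h0 : Tendsto (fun n : ℕ => 1 / (n : ℝ)) atTop (𝓝 0) := tendsto_one_div_atTop_nhds_zero_nat
  -- With `‖x‖` alone the roots would not tend to 1 when `x = 0`.
  have h2 : Tendsto (fun n : ℕ => (‖x‖ + 1) ^ (1 / (n : ℝ))) atTop (𝓝 1) := by
    have := (tendsto_const_nhds (x := ‖x‖ + 1)).rpow h0 (Or.inl (by positivity))
    simpa using this
  have h3 := h1.mul h2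
  rw [zero_mul] at h3
  refine squeeze_zero (fun n => by positivity) (fun n => ?_) h3
  rw [← Real.mul_rpow (by positivity) (by positivity)]
  refine Real.rpow_le_rpow (norm_nonneg _) ?_ (by positivity)
  refine ((T ^ n).le_opNorm x).trans ?_
  gcongr
  linarith

theorem coe_restrict_pow (T : X →L[ℂ] X) {Y : Submodule ℂ X} (h : ∀ x ∈ Y, T x ∈ Y) (n : ℕ)
    (y : Y) : (((T.restrict h) ^ n) y : X) = (T ^ n) y := by
  induction n with
  | zero => simp
  | succ n ih =>
    rw [pow_succ', pow_succ', mul_apply_eq_comp, mul_apply_eq_comp,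
      ContinuousLinearMap.coe_restrict_apply, ih]

theorem le_quasinilpotentPart_of_restrict [CompleteSpace X] {T : X →L[ℂ] X}
    {Y : Submodule ℂ X} (hY : IsClosed (Y : Set X)) {h : ∀ x ∈ Y, T x ∈ Y}
    (hT : IsQuasinilpotent (T.restrict h)) : Y ≤ quasinilpotentPart T := by
  intro x hx
  have : CompleteSpace Y := hY.completeSpace_coe
  have key : Tendsto (fun n : ℕ => ‖((T.restrict h) ^ n) ⟨x, hx⟩‖ ^ (1 / (n : ℝ))) atTop (𝓝 0) :=
    mem_quasinilpotentPart_of_isQuasinilpotent hT ⟨x, hx⟩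
  refine key.congr fun n => ?_
  rw [← coe_restrict_pow T h n ⟨x, hx⟩]
  rfl

end Operators

/-! ### Closed complements and idempotents. -/

section Operators

variable {X : Type*} [NormedAddCommGroup X] [NormedSpace ℂ X]

/-- A finite dimensional subspace that meets a closed subspace `R` trivially has a closed
complement containing `R`. -/
theorem exists_isClosed_isCompl_of_disjoint {F R : Submodule ℂ X} [FiniteDimensional ℂ F]
    (hR : IsClosed (R : Set X)) (hFR : Disjoint F R) :
    ∃ M : Submodule ℂ X, IsClosed (M : Set X) ∧ IsCompl F M ∧ R ≤ M := by
  -- `F` embeds in `X ⧸ R`, where its finite-dimensional image has a continuous projection; the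
  -- kernel of the pulled-back projection contains `R`.
  let π : X →L[ℂ] X ⧸ R := R.mkQL
  have hπ : ∀ x, π x = 0 ↔ x ∈ R := fun x => Submodule.Quotient.mk_eq_zero R
  let F' : Submodule ℂ (X ⧸ R) := F.map (π : X →ₗ[ℂ] X ⧸ R)
  obtain ⟨g, hg⟩ := Submodule.ClosedComplemented.of_finiteDimensional F'
  let q : X →L[ℂ] F' := g.comp π
  have hq : ∀ x ∈ F, (q x : X ⧸ R) = π x := fun x hx =>
    congrArg Subtype.val (hg ⟨π x, Submodule.mem_map_of_mem hx⟩)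
  refine ⟨q.ker, q.isClosed_ker, ⟨?_, ?_⟩, ?_⟩
  · rw [Submodule.disjoint_def]
    intro x hxF hxq
    have h0 : q x = 0 := hxq
    have h1 := hq x hxF
    rw [h0, Submodule.coe_zero] at h1
    exact Submodule.disjoint_def.mp hFR x hxF ((hπ x).mp h1.symm)
  · rw [codisjoint_iff, Submodule.eq_top_iff']
    intro x
    obtain ⟨f, hf, hfx⟩ := (q x).2
    refine Submodule.mem_sup.mpr ⟨f, hf, x - f, ?_, add_sub_cancel f x⟩
    show q (x - f) = 0
    rw [map_sub, sub_eq_zero]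
    exact Subtype.ext (hfx.symm.trans (hq f hf).symm)
  · intro x hx
    show g (π x) = 0
    rw [(hπ x).mpr hx, map_zero]

theorem IsQuasinilpotent.restrict_of_le_ker {T : X →L[ℂ] X} {Y : Submodule ℂ X}
    (h : ∀ x ∈ Y, T x ∈ Y) (hY : Y ≤ T.ker) : IsQuasinilpotent (T.restrict h) := by
  have : T.restrict h = 0 := by
    ext y
    exact hY y.2
  rw [this]
  exact isQuasinilpotent_zero

/-- The complementary decomposition attached to an idempotent operator. -/
theorem isCompl_ker_one_sub_ker {P : X →L[ℂ] X} (hP : P * P = P) :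
    IsCompl (1 - P).ker P.ker := by
  have hPP : ∀ x, P (P x) = P x := fun x => DFunLike.congr_fun hP x
  constructor
  · rw [Submodule.disjoint_def]
    intro x h1 h2
    have h1' : x - P x = 0 := h1
    have h2' : P x = 0 := h2
    rwa [h2', sub_zero] at h1'
  · rw [codisjoint_iff, Submodule.eq_top_iff']
    intro x
    refine Submodule.mem_sup.mpr ⟨P x, ?_, x - P x, ?_, add_sub_cancel (P x) x⟩
    · show P x - P (P x) = 0
      rw [hPP, sub_self]
    · show P (x - P x) = 0
      rw [map_sub, hPP, sub_self]

theorem isFredholm_of_leftInverse_rightInverse {Y : Type*} [NormedAddCommGroup Y]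
    [NormedSpace ℂ Y] (u v : Y →L[ℂ] Y) (h₁ : Function.LeftInverse v u)
    (h₂ : Function.RightInverse v u) : u.IsFredholm := by
  let e : Y ≃L[ℂ] Y := ContinuousLinearEquiv.equivOfInverse u v h₁ h₂
  exact ContinuousLinearMap.IsFredholm.of_isQuasiInverse (v := v) e.toLinearEquiv.isQuasiInverse

end Operators

/-! ### Implications that need no regularity. -/

section Multipliers

variable {A : Type*} [NonUnitalNormedCommRing A] [NormedSpace ℂ A]

/-- The complement of the kernel is chosen in `X₁` so as to contain the range, which makes it
`T`-invariant; its image under `T` is all of `T(X₁)`, hence closed. -/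
theorem IsMultiplier.isLeftGenDrazinInvertible [CompleteSpace A] (hA : IsSemisimple A) {T : A →L[ℂ] A}
    (hT : IsMultiplier T) (h : IsPseudoUpperSemiBFredholm T) : IsLeftGenDrazinInvertible T := by
  obtain ⟨X₁, X₂, h₁, h₂, hc₁, hc₂, hX, ⟨hfin, hran⟩, hq⟩ := h
  have hX₂ := le_quasinilpotentPart_of_restrict hc₂ hq
  rw [hT.quasinilpotentPart_eq_ker hA] at hX₂
  rw [IsLeftGenDrazinInvertible, hT.quasinilpotentPart_eq_ker hA]
  refine ⟨T.isClosed_ker, ?_⟩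
  have hdisj : Disjoint (T.restrict h₁).ker (T.restrict h₁).range := by
    rw [Submodule.disjoint_def]
    rintro _ hx ⟨y, rfl⟩
    apply Subtype.ext
    exact hT.apply_eq_zero_of_apply_apply_eq_zero hA (congrArg Subtype.val hx)
  obtain ⟨M, hMc, hM, hRM⟩ := exists_isClosed_isCompl_of_disjoint hran hdisj
  have hdec : ∀ x : X₁, ∃ m ∈ M, T x = T (m : X₁) := by
    intro x
    obtain ⟨f, hf, m, hm, rfl⟩ := Submodule.mem_sup.mp (hM.sup_eq_top ▸ Submodule.mem_top (x := x))
    refine ⟨m, hm, ?_⟩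
    have hf' : T f = 0 := congrArg Subtype.val hf
    rw [Submodule.coe_add, map_add, hf', zero_add]
  have hemb := hc₁.isClosedEmbedding_subtypeVal
  refine ⟨M.map X₁.subtype, hemb.isClosedMap _ hMc, ⟨?_, ?_⟩, ?_, ?_⟩
  · rw [Submodule.disjoint_def]
    rintro _ hx ⟨m, hm, rfl⟩
    have hm0 : m ∈ (T.restrict h₁).ker := Subtype.ext hx
    rw [Submodule.disjoint_def.mp hM.disjoint m hm0 hm, map_zero]
  · rw [codisjoint_iff, Submodule.eq_top_iff']
    intro x
    obtain ⟨x₁, hx₁, x₂, hx₂, rfl⟩ :=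
      Submodule.mem_sup.mp (hX.sup_eq_top ▸ Submodule.mem_top (x := x))
    obtain ⟨m, hm, hTm⟩ := hdec ⟨x₁, hx₁⟩
    refine Submodule.mem_sup.mpr ⟨x₁ + x₂ - m, ?_, m, ⟨m, hm, rfl⟩, sub_add_cancel _ _⟩
    have hx₂' : T x₂ = 0 := hX₂ hx₂
    show T (x₁ + x₂ - m) = 0
    rw [map_sub, map_add, hx₂', add_zero, hTm, sub_self]
  · rintro _ ⟨m, hm, rfl⟩
    exact ⟨T.restrict h₁ m, hRM ⟨m, rfl⟩, rfl⟩
  · have : T '' (M.map X₁.subtype : Submodule ℂ A) =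
        (Subtype.val '' ((T.restrict h₁).range : Set X₁) : Set A) := by
      ext y
      constructor
      · rintro ⟨_, ⟨m, hm, rfl⟩, rfl⟩
        exact ⟨T.restrict h₁ m, ⟨m, rfl⟩, rfl⟩
      · rintro ⟨_, ⟨x, rfl⟩, rfl⟩
        obtain ⟨m, hm, hTm⟩ := hdec x
        exact ⟨m, ⟨m, hm, rfl⟩, hTm.symm⟩
    rw [this]
    exact hemb.isClosedMap _ hran

theorem IsMultiplier.isPseudoUpperSemiBFredholm (hA : IsSemisimple A) {T : A →L[ℂ] A}
    (hT : IsMultiplier T) (h : IsLeftGenDrazinInvertible T) : IsPseudoUpperSemiBFredholm T := by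
  rw [IsLeftGenDrazinInvertible, hT.quasinilpotentPart_eq_ker hA] at h
  obtain ⟨hker, M, hMc, hM, hTM, hTMc⟩ := h
  have h₂ : ∀ x ∈ T.ker, T x ∈ T.ker := fun x hx => by
    have hx' : T x = 0 := hx
    rw [hx']
    exact zero_mem _
  refine ⟨M, T.ker, hTM, h₂, hMc, hker, hM.symm, ⟨?_, ?_⟩,
    IsQuasinilpotent.restrict_of_le_ker h₂ le_rfl⟩
  · have : (T.restrict hTM).ker = ⊥ := by
      rw [Submodule.eq_bot_iff]
      intro x hx
      have hx' : T x = 0 := congrArg Subtype.val hx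
      exact Subtype.ext (Submodule.disjoint_def.mp hM.disjoint x hx' x.2)
    rw [this]
    infer_instance
  · have : ((T.restrict hTM).range : Set M) = Subtype.val ⁻¹' (T '' (M : Set A)) := by
      ext y
      constructor
      · rintro ⟨x, rfl⟩
        exact ⟨x, x.2, rfl⟩
      · rintro ⟨x, hx, hxy⟩
        exact ⟨⟨x, hx⟩, Subtype.ext hxy⟩
    rw [this]
    exact hTMc.preimage continuous_subtype_val

/-- The idempotent `T * S` splits the space: `S` inverts `T` on its range, and its kernel lies in
`H₀(T) = N(T)`. -/
theorem IsMultiplier.isPseudoBFredholm [CompleteSpace A] (hA : IsSemisimple A) {T : A →L[ℂ] A}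
    (hT : IsMultiplier T) (h : IsGenDrazinInvertible T) : IsPseudoBFredholm T := by
  obtain ⟨S, hST, hS, hq⟩ := h
  have hcomm : ∀ x, S (T x) = T (S x) := fun x => DFunLike.congr_fun hST x
  have hSSx : ∀ x, S (S (T x)) = S x := fun x => DFunLike.congr_fun hS x
  have hP : (T * S) * (T * S) = T * S := by
    ext x
    show T (S (T (S x))) = T (S x)
    have : S (T (S x)) = S x := by rw [← hcomm x, hSSx]
    rw [this]
  have hker : (T * S).ker ≤ T.ker := by
    intro x hx
    have hx' : T (S x) = 0 := hx
    rw [← hT.quasinilpotentPart_eq_ker hA]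
    have key : Tendsto (fun n : ℕ => ‖((T - T ^ 2 * S) ^ n) x‖ ^ (1 / (n : ℝ))) atTop (𝓝 0) :=
      mem_quasinilpotentPart_of_isQuasinilpotent hq x
    refine key.congr fun n => ?_
    -- The orbit stays in the kernel of `T * S`, where the correction `T ^ 2 * S` vanishes.
    have : ((T - T ^ 2 * S) ^ n) x = (T ^ n) x ∧ T (S ((T ^ n) x)) = 0 := by
      induction n with
      | zero => exact ⟨rfl, hx'⟩
      | succ n ih =>
        rw [pow_succ' _ n, pow_succ' T n, mul_apply_eq_comp, mul_apply_eq_comp, ih.1]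
        constructor
        · show T _ - T (T (S _)) = _
          rw [ih.2, map_zero, sub_zero]
        · rw [hcomm, ih.2, map_zero]
    rw [this.1]
  have h₁ : ∀ x ∈ (1 - T * S).ker, T x ∈ (1 - T * S).ker := by
    intro x hx
    have hx' : x - T (S x) = 0 := hx
    show T x - T (S (T x)) = 0
    rw [hcomm, ← map_sub, hx', map_zero]
  have hS₁ : ∀ x ∈ (1 - T * S).ker, S x ∈ (1 - T * S).ker := by
    intro x hx
    have hx' : x - T (S x) = 0 := hx
    show S x - T (S (S x)) = 0
    rw [← hcomm (S x), ← map_sub, hx', map_zero]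
  have h₂ : ∀ x ∈ (T * S).ker, T x ∈ (T * S).ker := by
    intro x hx
    have hx' : T x = 0 := hker hx
    rw [hx']
    exact zero_mem _
  refine ⟨(1 - T * S).ker, (T * S).ker, h₁, h₂, (1 - T * S).isClosed_ker, (T * S).isClosed_ker,
    isCompl_ker_one_sub_ker hP,
    isFredholm_of_leftInverse_rightInverse _ (S.restrict hS₁) (fun x => ?_) (fun x => ?_),
    IsQuasinilpotent.restrict_of_le_ker h₂ hker⟩
  · apply Subtype.ext
    have hx : (x : A) - T (S x) = 0 := x.2
    show S (T x) = x
    rw [hcomm, ← sub_eq_zero.mp hx]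
  · apply Subtype.ext
    have hx : (x : A) - T (S x) = 0 := x.2
    show T (S x) = x
    rw [← sub_eq_zero.mp hx]

theorem IsPseudoBFredholm.isPseudoUpperSemiBFredholm {X : Type*} [NormedAddCommGroup X]
    [NormedSpace ℂ X] {T : X →L[ℂ] X} (h : IsPseudoBFredholm T) :
    IsPseudoUpperSemiBFredholm T := by
  obtain ⟨X₁, X₂, h₁, h₂, hc₁, hc₂, hX, hF, hq⟩ := h
  exact ⟨X₁, X₂, h₁, h₂, hc₁, hc₂, hX, ⟨hF.finite_ker, hF.isClosed_range⟩, hq⟩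

end Multipliers

/-! ### Relative inverses by holomorphic functional calculus. -/

section Unital

variable {B : Type*} [NormedCommRing B] [NormedAlgebra ℂ B] [CompleteSpace B]

/-- If the nonzero values of the Gelfand transform of `b` are bounded away from zero, its pointwise
inverse on the set where it does not vanish is again a Gelfand transform. -/
theorem exists_apply_mul_apply_eq_one {b : B} {δ : ℝ} (hδ : 0 < δ)
    (hb : ∀ χ : characterSpace ℂ B, χ b = 0 ∨ δ ≤ ‖χ b‖) :
    ∃ w : B, ∀ χ : B →ₐ[ℂ] ℂ, χ b ≠ 0 → χ w * χ b = 1 := by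
  have hr : 0 < δ / 2 := by positivity
  have hres : ∀ z ∈ Metric.sphere (0 : ℂ) (δ / 2), z ∈ resolventSet ℂ b := by
    intro z hz
    have hz' : ‖z‖ = δ / 2 := by simpa using hz
    by_contra hcon
    obtain ⟨χ, rfl⟩ := CharacterSpace.mem_spectrum_iff_exists.mp hcon
    rcases hb χ with h | h
    · rw [h, norm_zero] at hz'
      linarith
    · linarith
  have hcont : ContinuousOn (fun z : ℂ => (z - 0)⁻¹ • resolvent b z)
      (Metric.sphere (0 : ℂ) (δ / 2)) := by
    intro z hz
    have hz0 : z - 0 ≠ 0 := by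
      rintro h
      rw [sub_zero] at h
      rw [h, mem_sphere_zero_iff_norm, norm_zero] at hz
      linarith
    refine ContinuousAt.continuousWithinAt (ContinuousAt.smul ?_ ?_)
    · exact (continuousAt_id.sub continuousAt_const).inv₀ hz0
    · exact (spectrum.hasDerivAt_resolvent_const_left (hres z hz)).continuousAt
  -- The circle separates 0 from the nonzero spectrum. At `χ`, Cauchy's formula evaluates `(z - χ
  -- b)⁻¹` at 0, giving `-(χ b)⁻¹`; hence the sign.
  refine ⟨-((2 * Real.pi * Complex.I : ℂ)⁻¹ • ∮ z in C(0, δ / 2), (z - 0)⁻¹ • resolvent b z),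
    fun χ hχ => ?_⟩
  have hχδ : δ ≤ ‖χ b‖ := (hb (CharacterSpace.equivAlgHom.symm χ)).resolve_left hχ
  have hcomm : χ (∮ z in C(0, δ / 2), (z - 0)⁻¹ • resolvent b z) =
      ∮ z in C(0, δ / 2), (z - 0)⁻¹ • (z - χ b)⁻¹ := by
    have h1 : χ (∮ z in C(0, δ / 2), (z - 0)⁻¹ • resolvent b z) =
        ∮ z in C(0, δ / 2), χ ((z - 0)⁻¹ • resolvent b z) := by
      have h := (hcont.circleIntegrable hr.le).out
      have := (χ.toContinuousLinearMap).intervalIntegral_comp_comm h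
      simp only [circleIntegral]
      simpa using this.symm
    rw [h1]
    refine circleIntegral.integral_congr hr.le fun z hz => ?_
    simp only [map_smul]
    congr 1
    have hu : IsUnit (algebraMap ℂ B z - b) := hres z hz
    have h2 : resolvent b z * (algebraMap ℂ B z - b) = 1 := Ring.inverse_mul_cancel _ hu
    have h3 := congrArg χ h2
    rw [map_mul, map_sub, map_one, AlgHom.commutes] at h3
    exact eq_inv_of_mul_eq_one_left h3
  have hne : ∀ z ∈ Metric.closedBall (0 : ℂ) (δ / 2), z - χ b ≠ 0 := by
    intro z hz h
    rw [sub_eq_zero.mp h, mem_closedBall_zero_iff] at hz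
    linarith
  have hcauchy := DiffContOnCl.two_pi_i_inv_smul_circleIntegral_sub_inv_smul
    (f := fun z : ℂ => (z - χ b)⁻¹) (c := 0) (w := 0) (R := δ / 2)
    (DifferentiableOn.diffContOnCl (by
      rw [closure_ball _ hr.ne']
      intro z hz
      have hd : DifferentiableAt ℂ (fun z : ℂ => z - χ b) z := by fun_prop
      exact (hd.inv (hne z hz)).differentiableWithinAt))
    (Metric.mem_ball_self hr)
  rw [map_neg, map_smul, hcomm, hcauchy]
  field_simp
  ring

end Unital

/-! ### Unitization, and local membership in ideals of regular algebras. -/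

section Unitization

variable {A : Type*} [NonUnitalNormedCommRing A] [NormedSpace ℂ A] [IsScalarTower ℂ A A]
  [SMulCommClass ℂ A A]

/-- The unitization of a commutative Banach algebra, with the `ℓ¹` norm. -/
noncomputable instance : NormedCommRing (WithLp 1 (Unitization ℂ A)) :=
  { WithLp.instUnitizationNormedRing with
    mul_comm := fun x y => congrArg (WithLp.toLp 1) (mul_comm x.ofLp y.ofLp) }

/-- The embedding of a commutative Banach algebra into its unitization. -/
noncomputable def toUnitization : A →ₙₐ[ℂ] WithLp 1 (Unitization ℂ A) :=
  ((WithLp.unitizationAlgEquiv (𝕜 := ℂ) (A := A) ℂ).symm : _ →ₙₐ[ℂ] _).comp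
    (Unitization.inrNonUnitalAlgHom ℂ A)

/-- The extension of a character to the unitization. -/
noncomputable def extendCharacter (φ : characterSpace ℂ A) :
    WithLp 1 (Unitization ℂ A) →ₐ[ℂ] ℂ :=
  (Unitization.lift (CharacterSpace.toNonUnitalAlgHom φ)).comp
    (WithLp.unitizationAlgEquiv (𝕜 := ℂ) (A := A) ℂ : _ →ₐ[ℂ] _)

theorem extendCharacter_toUnitization (φ : characterSpace ℂ A) (a : A) :
    extendCharacter φ (toUnitization a) = φ a := by
  show Unitization.lift (CharacterSpace.toNonUnitalAlgHom φ) (a : Unitization ℂ A) = φ a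
  simp

theorem norm_toUnitization (a : A) : ‖toUnitization a‖ = ‖a‖ :=
  WithLp.unitization_norm_inr a

theorem toUnitization_injective : Function.Injective (toUnitization (A := A)) := fun a b h => by
  rw [← sub_eq_zero, ← norm_eq_zero, ← norm_toUnitization, map_sub, h, sub_self, norm_zero]

theorem continuous_toUnitization : Continuous (toUnitization (A := A)) :=
  WithLp.unitization_isometry_inr.continuous

theorem exists_eq_algebraMap_add (u : WithLp 1 (Unitization ℂ A)) :
    ∃ (c : ℂ) (x : A), u = algebraMap ℂ _ c + toUnitization x :=
  ⟨u.ofLp.fst, u.ofLp.snd, congrArg (WithLp.toLp 1) (Unitization.inl_fst_add_inr_snd_eq u.ofLp).symm⟩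

theorem exists_mul_toUnitization (u : WithLp 1 (Unitization ℂ A)) (a : A) :
    ∃ (c : ℂ) (x : A), u * toUnitization a = toUnitization (c • a + x * a) := by
  obtain ⟨c, x, rfl⟩ := exists_eq_algebraMap_add u
  refine ⟨c, x, ?_⟩
  rw [add_mul, map_add, map_mul, map_smul, Algebra.smul_def]

/-- A character of the unitization restricts to zero or to a character. -/
theorem eq_zero_or_exists_apply_toUnitization_eq
    (χ : characterSpace ℂ (WithLp 1 (Unitization ℂ A))) :
    (∀ a : A, χ (toUnitization a) = 0) ∨
      ∃ ψ : characterSpace ℂ A, ∀ a, χ (toUnitization a) = ψ a := by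
  by_cases h : ∀ a : A, χ (toUnitization a) = 0
  · exact Or.inl h
  · right
    let f : A →L[ℂ] ℂ :=
      { toFun := fun a => χ (toUnitization a)
        map_add' := fun a b => by simp only [map_add]
        map_smul' := fun c a => by simp only [map_smul, RingHom.id_apply]
        cont := (map_continuous χ).comp continuous_toUnitization }
    refine ⟨⟨f, ?_, fun a b => ?_⟩, fun a => rfl⟩
    · intro hf
      exact h fun a => DFunLike.congr_fun hf a
    · show χ (toUnitization (a * b)) = χ (toUnitization a) * χ (toUnitization b)
      rw [map_mul, map_mul]

/-- The ideal of the unitization of the elements on which all characters in `E` vanish. -/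
noncomputable def kernelIdeal (E : Set (characterSpace ℂ A)) :
    Ideal (WithLp 1 (Unitization ℂ A)) :=
  ⨅ φ : E, RingHom.ker (extendCharacter φ.1)

theorem mem_kernelIdeal {E : Set (characterSpace ℂ A)} {u : WithLp 1 (Unitization ℂ A)} :
    u ∈ kernelIdeal E ↔ ∀ φ ∈ E, extendCharacter φ u = 0 := by
  simp [kernelIdeal, Submodule.mem_iInf, RingHom.mem_ker]

variable [CompleteSpace A]

theorem isClosed_kernelIdeal (E : Set (characterSpace ℂ A)) :
    IsClosed (kernelIdeal E : Set (WithLp 1 (Unitization ℂ A))) := by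
  have : (kernelIdeal E : Set (WithLp 1 (Unitization ℂ A))) =
      ⋂ φ ∈ E, {u | extendCharacter φ u = 0} := by
    ext u
    simp [mem_kernelIdeal]
  rw [this]
  exact isClosed_biInter fun φ _ =>
    isClosed_eq (map_continuous (extendCharacter φ)) continuous_const

/-- In a regular commutative Banach algebra, an element whose Gelfand transform is bounded away
from zero on a closed set is invertible relative to that set. -/
theorem IsRegular.exists_apply_mul_apply_eq_one (hA : IsRegular A)
    {E : Set (characterSpace ℂ A)} (hE : IsClosed E) {y : A} {δ : ℝ} (hδ : 0 < δ)
    (hy : ∀ φ ∈ E, δ ≤ ‖φ y‖) : ∃ w : A, ∀ φ ∈ E, φ w * φ y = 1 := by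
  -- Closedness makes the quotient by this ideal a Banach algebra.
  have hcl : IsClosed (kernelIdeal E : Set (WithLp 1 (Unitization ℂ A))) := isClosed_kernelIdeal E
  let π : WithLp 1 (Unitization ℂ A) →ₐ[ℂ] WithLp 1 (Unitization ℂ A) ⧸ kernelIdeal E :=
    Ideal.Quotient.mkₐ ℂ (kernelIdeal E)
  have hπ : ∀ u ∈ kernelIdeal E, π u = 0 := fun u hu => Ideal.Quotient.eq_zero_iff_mem.mpr hu
  obtain ⟨W, hW⟩ := GenDrazin.exists_apply_mul_apply_eq_one (b := π (toUnitization y)) hδ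
    (fun χ => by
      let χ' : characterSpace ℂ (WithLp 1 (Unitization ℂ A)) :=
        CharacterSpace.equivAlgHom.symm ((CharacterSpace.equivAlgHom χ).comp π)
      have hχ' : ∀ u, χ' u = χ (π u) := fun _ => rfl
      rcases eq_zero_or_exists_apply_toUnitization_eq χ' with h | ⟨ψ, hψ⟩
      · exact Or.inl (h y)
      · right
        rw [← hχ', hψ]
        refine hy ψ ?_
        -- A character of the quotient kills `kernelIdeal E`, so by regularity its restriction to
        -- `A`, if nonzero, belongs to `E`.
        by_contra hψE
        obtain ⟨z, hz, hz0⟩ := hA E ψ hE hψE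
        apply hz0
        rw [← hψ, hχ', hπ, map_zero]
        exact mem_kernelIdeal.mpr fun φ hφ => by rw [extendCharacter_toUnitization, hz φ hφ])
  obtain ⟨u, rfl⟩ : ∃ u, π u = W := Ideal.Quotient.mk_surjective W
  have hu : ∀ φ ∈ E, extendCharacter φ u * φ y = 1 := by
    intro φ hφ
    have h := hW (Ideal.Quotient.liftₐ (kernelIdeal E) (extendCharacter φ)
      fun v hv => mem_kernelIdeal.mp hv φ hφ)
    have h1 : ∀ v, Ideal.Quotient.liftₐ (kernelIdeal E) (extendCharacter φ)
      (fun v hv => mem_kernelIdeal.mp hv φ hφ) (π v) = extendCharacter φ v := fun _ => rfl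
    rw [h1, h1, extendCharacter_toUnitization] at h
    refine h fun h0 => ?_
    have := hy φ hφ
    rw [h0, norm_zero] at this
    linarith
  -- `u` may lie outside `A`, but `u * u * y` lies in `A` and is also inverse to `y` on `E`.
  obtain ⟨c, x, hw⟩ := exists_mul_toUnitization (u * u) y
  refine ⟨c • y + x * y, fun φ hφ => ?_⟩
  rw [← extendCharacter_toUnitization φ (c • y + x * y), ← hw, map_mul, map_mul,
    extendCharacter_toUnitization]
  linear_combination (extendCharacter φ u * φ y + 1) * hu φ hφ

/-- If `φ y ≠ 0`, invert `y` relative to the set where its transform has modulus at least `‖φ y‖ /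
2`, a neighbourhood of `φ`, and multiply by `y`. -/
theorem IsRegular.exists_eventually_apply_eq_one (hA : IsRegular A) (φ : characterSpace ℂ A) :
    ∃ e : A, ∀ᶠ ψ in 𝓝 φ, ψ e = 1 := by
  obtain ⟨y, hy⟩ := exists_apply_ne_zero φ
  have hy' : 0 < ‖φ y‖ / 2 := by positivity
  obtain ⟨w, hw⟩ := hA.exists_apply_mul_apply_eq_one (E := {ψ | ‖φ y‖ / 2 ≤ ‖ψ y‖})
    (isClosed_le continuous_const (continuous_apply y).norm) hy' fun ψ hψ => hψ
  refine ⟨w * y, ?_⟩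
  have : ∀ᶠ ψ : characterSpace ℂ A in 𝓝 φ, ‖φ y‖ / 2 < ‖ψ y‖ :=
    (continuous_apply y).norm.continuousAt.eventually (lt_mem_nhds (by linarith))
  filter_upwards [this] with ψ hψ
  rw [map_mul, hw ψ hψ.le]

/-- Local membership in an ideal implies membership, for elements with compact support. -/
theorem mem_of_forall_exists_mul_mem (hss : IsSemisimple A) (hA : IsRegular A)
    {J : Submodule ℂ A} (hJ : ∀ x, ∀ j ∈ J, x * j ∈ J) {a : A}
    (ha : HasCompactSupport fun φ : characterSpace ℂ A => φ a)
    (h : ∀ φ : characterSpace ℂ A, ∃ u, φ u ≠ 0 ∧ u * a ∈ J) : a ∈ J := by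
  -- The conductor of `a` into `J`. If proper, it is killed by a character, which either restricts
  -- to one of `A`, against `h`, or vanishes on `A`, against compact support.
  let I : Ideal (WithLp 1 (Unitization ℂ A)) :=
    { carrier := {u | ∃ j ∈ J, u * toUnitization a = toUnitization j}
      zero_mem' := ⟨0, J.zero_mem, by rw [zero_mul, map_zero]⟩
      add_mem' := by
        rintro u v ⟨j, hj, hu⟩ ⟨k, hk, hv⟩
        exact ⟨j + k, J.add_mem hj hk, by rw [add_mul, hu, hv, map_add]⟩
      smul_mem' := by
        rintro v u ⟨j, hj, hu⟩
        obtain ⟨c, x, hx⟩ := exists_mul_toUnitization v j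
        exact ⟨c • j + x * j, J.add_mem (J.smul_mem c hj) (hJ x j hj), by
          rw [smul_eq_mul, mul_assoc, hu, hx]⟩ }
  by_contra haJ
  have hI : I ≠ ⊤ := by
    rw [Ne, Ideal.eq_top_iff_one]
    rintro ⟨j, hj, h1⟩
    rw [one_mul] at h1
    exact haJ (toUnitization_injective h1 ▸ hj)
  obtain ⟨m, hm, hIm⟩ := I.exists_le_maximal hI
  have hχ : ∀ u ∈ I, m.toCharacterSpace u = 0 := fun u hu =>
    m.toCharacterSpace_apply_eq_zero_of_mem (hIm hu)
  rcases eq_zero_or_exists_apply_toUnitization_eq m.toCharacterSpace with h0 | ⟨ψ, hψ⟩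
  · choose e he using hA.exists_eventually_apply_eq_one
    obtain ⟨t, -, ht⟩ := IsCompact.elim_nhds_subcover ha (fun φ => {ψ | ψ (e φ) = 1})
      fun φ _ => he φ
    have hprod : ∏ φ ∈ t, (1 - toUnitization (e φ)) ∈ I := by
      obtain ⟨c, x, hx⟩ := exists_mul_toUnitization (∏ φ ∈ t, (1 - toUnitization (e φ))) a
      refine ⟨_, ?_, hx⟩
      have : c • a + x * a = 0 := by
        refine hss _ fun ψ => ?_
        rw [← extendCharacter_toUnitization, ← hx, map_mul, extendCharacter_toUnitization]
        by_cases hψ : ψ a = 0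
        · rw [hψ, mul_zero]
        · obtain ⟨φ, hφ, hφψ⟩ := Set.mem_iUnion₂.mp (ht (subset_tsupport _ hψ))
          have hφψ' : ψ (e φ) = 1 := hφψ
          rw [map_prod, Finset.prod_eq_zero hφ, zero_mul]
          rw [map_sub, map_one, extendCharacter_toUnitization, hφψ', sub_self]
      rw [this]
      exact J.zero_mem
    -- A character vanishing on `A` takes the value 1 on this product.
    have h1 := hχ _ hprod
    rw [map_prod] at h1
    simp [h0] at h1
  · obtain ⟨u, hu, hua⟩ := h ψ
    refine hu ?_
    rw [← hψ]
    exact hχ _ ⟨_, hua, (map_mul toUnitization u a).symm⟩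

end Unitization

/-! ### The gap in the symbol and generalized Drazin invertibility. -/

section Spectrum

variable {A : Type*} [NonUnitalNormedCommRing A] [NormedSpace ℂ A] [IsScalarTower ℂ A A]
  [SMulCommClass ℂ A A] [CompleteSpace A]

/-- On a regular algebra, the nonzero values of the symbol of a multiplier that is bounded below
on its range are bounded away from zero. -/
theorem IsMultiplier.le_norm_symbol (hss : IsSemisimple A) (hreg : IsRegular A) {T : A →L[ℂ] A}
    (hT : IsMultiplier T) {c : ℝ} (hc : 0 < c) (hTc : ∀ x, c * ‖T x‖ ≤ ‖T (T x)‖)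
    {φ : characterSpace ℂ A} {s : ℂ} (hs : ∀ y, φ (T y) = s * φ y) (hs0 : s ≠ 0) : c ≤ ‖s‖ := by
  by_contra! hsc
  obtain ⟨v, hv⟩ := exists_apply_ne_zero φ
  have hy : φ (T v) ≠ 0 := by
    rw [hs]
    exact mul_ne_zero hs0 hv
  have hδ : 0 < ‖φ (T v)‖ / 2 := by positivity
  let E : Set (characterSpace ℂ A) := {ψ | ‖φ (T v)‖ / 2 ≤ ‖ψ (T v)‖}
  obtain ⟨w, hw⟩ := hreg.exists_apply_mul_apply_eq_one (E := E)
    (isClosed_le continuous_const (continuous_apply _).norm) hδ fun ψ hψ => hψ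
  obtain ⟨b, hb, hφb⟩ := hreg {ψ | ‖ψ (T v)‖ ≤ ‖φ (T v)‖ / 2} φ
    (isClosed_le (continuous_apply _).norm continuous_const) (by
      show ¬ ‖φ (T v)‖ ≤ ‖φ (T v)‖ / 2
      linarith)
  -- Since `T (v * w)` has transform 1 on `E`, which carries `b`, this is a backward orbit of `b`.
  -- Its norms grow at most like `c⁻ⁿ`, while `φ (x n) = s⁻ⁿ φ b`, which is impossible for `‖s‖ <
  -- c`.
  let x : ℕ → A := fun n => (fun z => v * (w * z))^[n] b
  have hx_succ : ∀ n, x (n + 1) = v * (w * x n) := fun n => Function.iterate_succ_apply' _ n b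
  have hxE : ∀ n, ∀ ψ ∉ E, ψ (x n) = 0 := by
    intro n
    induction n with
    | zero => exact fun ψ hψ => hb ψ (show ‖ψ (T v)‖ ≤ ‖φ (T v)‖ / 2 from le_of_not_ge hψ)
    | succ n ih =>
      intro ψ hψ
      rw [hx_succ, _root_.map_mul, _root_.map_mul, ih ψ hψ, mul_zero, mul_zero]
  have hTx : ∀ n, T (x (n + 1)) = x n := by
    intro n
    refine hss.ext fun ψ => ?_
    rw [hx_succ, hT.map_mul hss, _root_.map_mul, _root_.map_mul]
    by_cases hψ : ψ ∈ E
    · linear_combination ψ (x n) * hw ψ hψ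
    · rw [hxE n ψ hψ, mul_zero, mul_zero]
  have hnorm : ∀ n, c ^ n * ‖x n‖ ≤ ‖b‖ := by
    intro n
    induction n with
    | zero => simp [x]
    | succ n ih =>
      -- The lower bound holds only on the range, so `x (n + 1)` is used as `T (x (n + 2))`.
      have h := hTc (x (n + 2))
      rw [hTx, hTx] at h
      calc c ^ (n + 1) * ‖x (n + 1)‖ = c ^ n * (c * ‖x (n + 1)‖) := by ring
        _ ≤ c ^ n * ‖x n‖ := by gcongr
        _ ≤ ‖b‖ := ih
  have hφx : ∀ n, φ b = s ^ n * φ (x n) := by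
    intro n
    induction n with
    | zero => simp [x]
    | succ n ih => rw [ih, ← hTx n, hs, pow_succ, mul_assoc]
  have hle : ∀ n : ℕ, ‖φ b‖ ≤ (‖s‖ / c) ^ n * (‖CharacterSpace.toCLM φ‖ * ‖b‖) := by
    intro n
    rw [hφx n, norm_mul, norm_pow, div_pow, div_mul_eq_mul_div, mul_div_assoc]
    gcongr
    rw [le_div_iff₀ (by positivity)]
    calc ‖φ (x n)‖ * c ^ n ≤ (‖CharacterSpace.toCLM φ‖ * ‖x n‖) * c ^ n := by
          gcongr
          exact (CharacterSpace.toCLM φ).le_opNorm _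
      _ = ‖CharacterSpace.toCLM φ‖ * (c ^ n * ‖x n‖) := by ring
      _ ≤ _ := by
          gcongr
          exact hnorm n
  have hlim : Tendsto (fun n : ℕ => (‖s‖ / c) ^ n * (‖CharacterSpace.toCLM φ‖ * ‖b‖)) atTop
      (𝓝 0) := by
    have := (tendsto_pow_atTop_nhds_zero_of_lt_one (r := ‖s‖ / c) (by positivity)
      ((div_lt_one hc).mpr hsc)).mul_const (‖CharacterSpace.toCLM φ‖ * ‖b‖)
    rwa [zero_mul] at this
  exact hφb (norm_le_zero_iff.mp (ge_of_tendsto' hlim hle))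

/-- On a regular Tauberian algebra, the sum of the kernel and the range of a multiplier that is
bounded below on its range is dense. -/
theorem IsMultiplier.dense_ker_sup_range (hss : IsSemisimple A) (hreg : IsRegular A)
    (htaub : IsTauberian A) {T : A →L[ℂ] A} (hT : IsMultiplier T) {c : ℝ} (hc : 0 < c)
    (hTc : ∀ x, c * ‖T x‖ ≤ ‖T (T x)‖) : Dense ((T.ker ⊔ T.range : Submodule ℂ A) : Set A) := by
  refine htaub.mono fun a ha => mem_of_forall_exists_mul_mem hss hreg ?_ ha ?_
  · intro x j hj
    obtain ⟨n, hn, _, ⟨z, rfl⟩, rfl⟩ := Submodule.mem_sup.mp hj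
    have hn' : T n = 0 := hn
    refine Submodule.mem_sup.mpr ⟨x * n, ?_, x * T z, ⟨z * x, ?_⟩, (mul_add _ _ _).symm⟩
    · show T (x * n) = 0
      rw [mul_comm, hT.map_mul hss, hn', zero_mul]
    · show T (z * x) = x * T z
      rw [hT.map_mul hss, mul_comm]
  · intro φ
    choose τ hτ using hT.exists_symbol
    by_cases hφ : τ φ = 0
    · have hopen : IsOpen {ψ | τ ψ = 0} := by
        rw [isOpen_iff_mem_nhds]
        intro ψ hψ
        obtain ⟨x, hx⟩ := exists_apply_ne_zero ψ
        have hlt : ‖ψ (T x)‖ < c * ‖ψ x‖ := by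
          rw [hτ, show τ ψ = 0 from hψ, zero_mul, norm_zero]
          positivity
        have hev := (continuous_apply (T x)).norm.continuousAt.eventually_lt
          ((continuous_apply x).norm.const_mul c).continuousAt hlt
        -- Here the symbol has modulus below `c`, so the gap forces it to vanish.
        filter_upwards [hev] with χ hχ
        by_contra hne
        have hle := hT.le_norm_symbol hss hreg hc hTc (hτ χ) hne
        rw [hτ, norm_mul] at hχ
        exact absurd hχ (not_lt.mpr (by gcongr))
      obtain ⟨u, hu, hφu⟩ := hreg _ φ hopen.isClosed_compl (fun h => h hφ)
      refine ⟨u, hφu, Submodule.mem_sup_left ?_⟩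
      have hTu : T u = 0 := hss _ fun ψ => by
        rw [hτ]
        by_cases hψ : τ ψ = 0
        · rw [hψ, zero_mul]
        · rw [hu ψ hψ, mul_zero]
      show T (u * a) = 0
      rw [hT.map_mul hss, hTu, zero_mul]
    · obtain ⟨x, hx⟩ := exists_apply_ne_zero φ
      refine ⟨T x, ?_, Submodule.mem_sup_right ⟨x * a, hT.map_mul hss x a⟩⟩
      rw [hτ]
      exact mul_ne_zero hφ hx

theorem IsMultiplier.isGenDrazinInvertible (hss : IsSemisimple A) (hreg : IsRegular A)
    (htaub : IsTauberian A) {T : A →L[ℂ] A} (hT : IsMultiplier T)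
    (h : IsLeftGenDrazinInvertible T) : IsGenDrazinInvertible T := by
  rw [IsLeftGenDrazinInvertible, hT.quasinilpotentPart_eq_ker hss] at h
  obtain ⟨hker, M, hMc, hM, hTM, hTMc⟩ := h
  have : CompleteSpace M := hMc.completeSpace_coe
  have htop := Submodule.IsCompl.isTopCompl_of_isClosed hM.symm hMc hker
  let P : A →L[ℂ] M := M.projectionOntoL T.ker htop
  have hPM : ∀ x : M, P x = x := fun x => Submodule.projectionOntoL_apply_left htop x
  have hTP : ∀ x, T (P x) = T x := by
    intro x
    have hx : P (x - P x) = 0 := by rw [map_sub, hPM, sub_self]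
    have hx' : T (x - P x) = 0 := (Submodule.projectionOntoL_apply_eq_zero_iff htop).mp hx
    rw [map_sub] at hx'
    exact (sub_eq_zero.mp hx').symm
  have hrange : T '' (M : Set A) = (T.range : Set A) := by
    ext y
    constructor
    · rintro ⟨x, -, rfl⟩
      exact ⟨x, rfl⟩
    · rintro ⟨x, rfl⟩
      exact ⟨P x, (P x).2, hTP x⟩
  have hRM : ∀ x, T x ∈ M := fun x => hTP x ▸ hTM _ (P x).2
  have hinj : Function.Injective (T.domRestrict M) := by
    rw [injective_iff_map_eq_zero]
    intro x hx
    exact Subtype.ext (Submodule.disjoint_def.mp hM.disjoint x hx x.2)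
  obtain ⟨K, hK⟩ := (T.domRestrict M).antilipschitz_of_injective_of_isClosed_range hinj (by
    convert hTMc using 1
    ext y
    simp)
  -- `K + 1` replaces `K`, which may be 0.
  have hTc : ∀ x, ((K : ℝ) + 1)⁻¹ * ‖T x‖ ≤ ‖T (T x)‖ := by
    intro x
    have h1 : ‖T x‖ ≤ K * ‖T (T x)‖ :=
      (T.domRestrict M).bound_of_antilipschitz hK ⟨T x, hRM x⟩
    rw [inv_mul_le_iff₀ (by positivity)]
    nlinarith [norm_nonneg (T (T x))]
  have hdense := hT.dense_ker_sup_range hss hreg htaub (c := ((K : ℝ) + 1)⁻¹) (by positivity) hTc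
  -- `P` kills the kernel and fixes the range; density and closedness of `T(M)` extend the inclusion
  -- to all of `A`.
  have hsub : ((T.ker ⊔ T.range : Submodule ℂ A) : Set A) ⊆ {x | (P x : A) ∈ T '' (M : Set A)} := by
    intro x hx
    obtain ⟨n, hn, _, ⟨z, rfl⟩, rfl⟩ := Submodule.mem_sup.mp hx
    have hPn : P n = 0 := (Submodule.projectionOntoL_apply_eq_zero_iff htop).mpr hn
    have hPz : P (T z) = ⟨T z, hRM z⟩ := hPM ⟨T z, hRM z⟩
    show (P (n + T z) : A) ∈ T '' (M : Set A)
    rw [map_add, hPn, zero_add, hPz, hrange]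
    exact ⟨z, rfl⟩
  have hmem : ∀ x, (P x : A) ∈ T '' (M : Set A) := fun x =>
    (hTMc.preimage (continuous_subtype_val.comp P.continuous)).closure_subset_iff.mpr hsub
      (hdense x)
  have hbij : Function.Bijective (T.restrict hTM) := by
    refine ⟨fun x y hxy => hinj (congrArg Subtype.val hxy), fun y => ?_⟩
    obtain ⟨x, hx, hxy⟩ := hmem y
    rw [hPM] at hxy
    exact ⟨⟨x, hx⟩, Subtype.ext hxy⟩
  let e : M ≃L[ℂ] M := ContinuousLinearEquiv.ofBijective (T.restrict hTM)
    (LinearMap.ker_eq_bot.mpr hbij.1) (LinearMap.range_eq_top.mpr hbij.2)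
  have he : ∀ x : M, e x = T.restrict hTM x := fun _ => rfl
  let S : A →L[ℂ] A := M.subtypeL.comp ((e.symm : M →L[ℂ] M).comp P)
  have hS : ∀ x, S x = e.symm (P x) := fun _ => rfl
  have hTS : ∀ x, T (S x) = P x := by
    intro x
    rw [hS]
    exact congrArg Subtype.val (e.apply_symm_apply (P x))
  have hST : ∀ x, S (T x) = P x := by
    intro x
    have : P (T x) = e (P x) := by
      rw [← hTP x]
      exact hPM ⟨T (P x), hTM _ (P x).2⟩
    rw [hS, this, e.symm_apply_apply]
  refine ⟨S, ?_, ?_, ?_⟩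
  · ext x
    exact (hST x).trans (hTS x).symm
  · ext x
    show S (S (T x)) = S x
    rw [hST, hS, hPM, hS]
  · have : T - T ^ 2 * S = 0 := by
      ext x
      show T x - T (T (S x)) = 0
      rw [hTS, hTP, sub_self]
    rw [this]
    exact isQuasinilpotent_zero

end Spectrum

end GenDrazin

theorem mainTheorem10 {A : Type*} [NonUnitalNormedCommRing A] [NormedSpace ℂ A]
    [IsScalarTower ℂ A A] [SMulCommClass ℂ A A] [CompleteSpace A]
    (hA : GenDrazin.IsSemisimple A) (T : A → A) (hT : GenDrazin.IsMultiplier T) :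
    ∃ S : A →L[ℂ] A, (∀ x, S x = T x) ∧
      (GenDrazin.IsPseudoUpperSemiBFredholm S ↔ GenDrazin.IsLeftGenDrazinInvertible S) ∧
      (GenDrazin.IsRegular A → GenDrazin.IsTauberian A →
        (GenDrazin.IsPseudoBFredholm S ↔ GenDrazin.IsGenDrazinInvertible S)) := by
  obtain ⟨S, hS⟩ := hT.exists_continuousLinearMap hA
  have hSm : GenDrazin.IsMultiplier S := (funext hS : ⇑S = T) ▸ hT
  exact ⟨S, hS, ⟨hSm.isLeftGenDrazinInvertible hA, hSm.isPseudoUpperSemiBFredholm hA⟩,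
    -- Only the upper semi-Fredholm half of the Fredholm condition is needed here.
    fun hreg htaub => ⟨fun h => hSm.isGenDrazinInvertible hA hreg htaub
      (hSm.isLeftGenDrazinInvertible hA h.isPseudoUpperSemiBFredholm), hSm.isPseudoBFredholm hA⟩⟩
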